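/- For integers $0\le r\le n$, let $\mathcal M_{r,n}$ be the set of isomorphism classes of matroids of rank $r$ on $[n]=\{1,\dots,n\}$. For a matroid $M$ on $[n]$ let $\mathscr P(M)\subseteq\mathbb R^n$ be its base polytope, the convex hull of the zero-one indicator vectors of its bases, and let $\mathbf 1_{\mathscr P(M)}:\mathbb R^n\to\mathbb Z$ be the indicator function of $\mathscr P(M)$. A function $f:\mathcal M_{r,n}\to\mathbb R$ is called a valuative invariant if $\sum_{i=1}^s a_i f([M_i])=0$ for all matroids $M_1,\dots,M_s$ of rank $r$ on $[n]$ and all $a_1,\dots,a_s\in\mathbb Z$ such that $\sum_{i=1}^s a_i\mathbf 1_{\mathscr P(M_i)}$ is identically zero on $\mathbb R^n$. Theorem. There exists a valuative invariant $f:\mathcal M_{3,19}\to\mathbb R$ such that $f([M])\ge 0$ for every matroid $M$ of rank $3$ on $[19]$ that is representable over some field, and $f([M])<0$ for at least one matroid $M$ of rank $3$ on $[19]$ that is not representable over any field. -/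

import Mathlib

universe u v

/-- Labelled matroids of rank `r` with ground set `[n]` (modelled by `Fin n`). -/
def LabelledMatroid (r n : ℕ) : Type :=
  {M : Matroid (Fin n) // M.E = Set.univ ∧ M.eRank = r}

namespace LabelledMatroid

variable {r n : ℕ}

/-- Two labelled matroids are isomorphic if a permutation of the ground set carries one to
the other. -/
def Iso (M N : LabelledMatroid r n) : Prop :=
  ∃ σ : Equiv.Perm (Fin n), N.1 = M.1.mapEquiv σ

theorem iso_iff {M N : LabelledMatroid r n} :
    M.Iso N ↔ ∃ σ : Equiv.Perm (Fin n), ∀ I : Set (Fin n), N.1.Indep (σ '' I) ↔ M.1.Indep I := by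
  constructor
  · rintro ⟨σ, hσ⟩
    refine ⟨σ, fun I => ?_⟩
    rw [hσ, Matroid.mapEquiv_indep_iff, Equiv.symm_image_image]
  · rintro ⟨σ, hσ⟩
    refine ⟨σ, Matroid.ext_indep ?_ fun I _ => ?_⟩
    · rw [Matroid.mapEquiv_ground_eq, M.2.1, N.2.1, Set.image_univ, σ.surjective.range_eq]
    · rw [Matroid.mapEquiv_indep_iff, ← hσ, Equiv.image_symm_image]

/-- Isomorphism of labelled matroids as an equivalence relation. -/
instance isoSetoid (r n : ℕ) : Setoid (LabelledMatroid r n) where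
  r := Iso
  iseqv :=
    { refl := fun _ => iso_iff.2 ⟨1, fun I => by simp⟩
      symm := fun h => by
        obtain ⟨σ, hσ⟩ := iso_iff.1 h
        exact iso_iff.2 ⟨σ.symm, fun I => by rw [← hσ, Equiv.image_symm_image]⟩
      trans := fun h₁ h₂ => by
        obtain ⟨σ, hσ⟩ := iso_iff.1 h₁
        obtain ⟨τ, hτ⟩ := iso_iff.1 h₂
        refine iso_iff.2 ⟨σ.trans τ, fun I => ?_⟩
        rw [← hσ, ← hτ, Equiv.coe_trans, Set.image_comp] }

/-- The base polytope of a matroid: the convex hull in `ℝⁿ` of the zero-one indicator vectors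
of its bases. -/
def basePolytope (M : LabelledMatroid r n) : Set (Fin n → ℝ) :=
  convexHull ℝ {x | ∃ B : Set (Fin n), M.1.IsBase B ∧ x = B.indicator 1}

/-- The integer-valued indicator function of the base polytope, on `ℝⁿ`. -/
noncomputable def polytopeIndicator (M : LabelledMatroid r n) : (Fin n → ℝ) → ℤ :=
  M.basePolytope.indicator 1

/-- A matroid is representable over the field `F` if it is the matroid of linear independence
of the columns of some matrix over `F`. -/
def IsRepresentableOver (M : LabelledMatroid r n) (F : Type u) [Field F] : Prop :=
  ∃ (m : ℕ) (A : Matrix (Fin m) (Fin n) F),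
    ∀ I : Set (Fin n), M.1.Indep I ↔ LinearIndepOn F A.col I

theorem IsRepresentableOver.of_iso {M N : LabelledMatroid r n} {F : Type u} [Field F]
    (h : M.Iso N) (hM : M.IsRepresentableOver F) : N.IsRepresentableOver F := by
  obtain ⟨σ, hσ⟩ := iso_iff.1 h
  obtain ⟨m, A, hA⟩ := hM
  refine ⟨m, A.submatrix id σ.symm, fun I => ?_⟩
  have h1 : (A.submatrix id σ.symm).col = A.col ∘ σ.symm := rfl
  rw [h1, linearIndepOn_equiv, ← hA, ← hσ, Equiv.image_symm_image]

end LabelledMatroid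

/-- A function on labelled matroids with values in an abelian group is valuative if every
integer linear relation among indicator functions of base polytopes also holds among its
values. -/
def IsValuative {r n : ℕ} {A : Type v} [AddCommGroup A] (f : LabelledMatroid r n → A) : Prop :=
  ∀ (s : ℕ) (a : Fin s → ℤ) (M : Fin s → LabelledMatroid r n),
    ∑ i, a i • (M i).polytopeIndicator = 0 → ∑ i, a i • f (M i) = 0

/-- Isomorphism classes of matroids of rank `r` on `n` elements. -/
def MatroidClass (r n : ℕ) : Type :=
  Quotient (LabelledMatroid.isoSetoid r n)

/-- The isomorphism class of a labelled matroid. -/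
def LabelledMatroid.toClass {r n : ℕ} (M : LabelledMatroid r n) : MatroidClass r n :=
  Quotient.mk _ M

/-- An invariant, that is, a function on isomorphism classes, is valuative if the induced
function on labelled matroids is. -/
def IsValuativeInvariant {r n : ℕ} {A : Type v} [AddCommGroup A] (f : MatroidClass r n → A) :
    Prop :=
  IsValuative fun M : LabelledMatroid r n => f M.toClass

/-- Representability over a field `F` of an isomorphism class of matroids. -/
def MatroidClass.IsRepresentableOver {r n : ℕ} (c : MatroidClass r n) (F : Type u) [Field F] :
    Prop :=
  Quotient.lift (fun M : LabelledMatroid r n => M.IsRepresentableOver F)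
    (fun _ _ h => propext
      ⟨fun hM => hM.of_iso h, fun hN => hN.of_iso (Setoid.symm h)⟩) c

/-! The invariant counts line sizes. For distinct a, b the set of s with {a, b, s} a base is seen by
the polytope: e_a + e_b plus the average of e_s over a nonempty set S lies in it exactly when S is
contained in that set. Inclusion-exclusion over S, with the Euler characteristic covering S empty,
makes every function of this set valuative. Its complement is the line through a and b, or all
points if a and b are dependent.

Sum over ordered pairs the weight 0 for lines of size 7, 1 for size 3, and 228 otherwise, and
subtract 228. A negative value leaves only sizes 3 and 7, with more than 19 · 18 - 228 = 114 pairs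
on 7-lines. Counting then forces three 7-lines through a common point, the other lines forming a
Latin square of order six (`exists_forall_card_line_eq_seven`). Over a field, suitable coordinates
turn the square into sets A, B, C of six scalars with A + B ⊆ C. So the additive group has a
subgroup of order six, and the field would have characteristic both 2 and 3. The addition table of
the integers modulo six does give a matroid, with value 216 - 228 = -12. -/

/-! ### Euler characteristic of compact convex sets -/

/-- Among finitely many compact intervals, a linear relation between the indicator functions
is also a relation between the Euler characteristics. -/
theorem sum_filter_nonempty_real {ι : Type*} (s : Finset ι) (a : ι → ℤ) (I : ι → Set ℝ)
    (hc : ∀ i, IsCompact (I i)) (hI : ∀ i, Convex ℝ (I i))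
    (h : ∀ x, (open Classical in ∑ i ∈ s with x ∈ I i, a i) = 0) :
    (open Classical in ∑ i ∈ s with (I i).Nonempty, a i) = 0 := by
  classical
  -- Group by left endpoint t: each group's sum is the value at t minus the value just left of t,
  -- both zero.
  rw [← Finset.sum_fiberwise_of_maps_to (t := s.image fun i => sInf (I i))
    (g := fun i => sInf (I i))
    (fun i hi => Finset.mem_image_of_mem _ (Finset.mem_of_mem_filter i hi))]
  refine Finset.sum_eq_zero fun t _ => ?_
  have key : ∀ i ∈ s, ∀ᶠ x in nhdsWithin t (Set.Iio t),
      (x ∈ I i ↔ t ∈ I i ∧ sInf (I i) ≠ t) := by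
    intro i _
    by_cases ht : t ∈ I i
    · by_cases hl : sInf (I i) = t
      · filter_upwards [self_mem_nhdsWithin] with x hx
        have : x ∉ I i := fun hxI =>
          absurd (csInf_le (hc i).bddBelow hxI) (by rw [hl]; exact not_le.2 hx)
        simp [this, hl]
      · have hlt : sInf (I i) < t := lt_of_le_of_ne (csInf_le (hc i).bddBelow ht) hl
        filter_upwards [Ioo_mem_nhdsLT hlt] with x hx
        have : x ∈ I i :=
          (hI i).ordConnected.out ((hc i).sInf_mem ⟨t, ht⟩) ht ⟨hx.1.le, hx.2.le⟩
        simp [this, ht, hl]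
    · filter_upwards [nhdsWithin_le_nhds ((hc i).isClosed.isOpen_compl.mem_nhds ht)] with x hx
      simp only [Set.mem_compl_iff] at hx
      simp [ht, hx]
  obtain ⟨x, hx⟩ := ((Filter.eventually_all_finset s).2 key).exists
  have h1 := h x
  rw [Finset.filter_congr hx, ← Finset.filter_filter] at h1
  have h2 := h t
  rw [← Finset.sum_filter_add_sum_filter_not _ (fun i => sInf (I i) = t), h1, add_zero] at h2
  rw [← h2, Finset.filter_filter, Finset.filter_filter]
  refine Finset.sum_congr (Finset.filter_congr fun i _ => ?_) fun _ _ => rfl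
  constructor
  · rintro ⟨hne, rfl⟩
    exact ⟨(hc i).sInf_mem hne, rfl⟩
  · rintro ⟨ht, hl⟩
    exact ⟨⟨t, ht⟩, hl⟩

/-- A linear relation between the indicator functions of finitely many compact convex sets
is also a relation between their Euler characteristics. -/
theorem sum_filter_nonempty {ι : Type*} (s : Finset ι) (a : ι → ℤ) :
    ∀ {d : ℕ} (P : ι → Set (Fin d → ℝ)), (∀ i, IsCompact (P i)) → (∀ i, Convex ℝ (P i)) →
    (∀ x, (open Classical in ∑ i ∈ s with x ∈ P i, a i) = 0) →
    (open Classical in ∑ i ∈ s with (P i).Nonempty, a i) = 0 := by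
  classical
  intro d
  induction d with
  | zero =>
    intro P _ _ h
    rw [← h default]
    refine Finset.sum_congr (Finset.filter_congr fun i _ => ?_) fun _ _ => rfl
    exact ⟨fun ⟨x, hx⟩ => Subsingleton.elim x default ▸ hx, fun hx => ⟨_, hx⟩⟩
  | succ d ih =>
    intro P hc hP h
    -- Project to the first coordinate; the induction hypothesis on the slices supplies the relation
    -- between the image intervals.
    have h1 := sum_filter_nonempty_real s a (fun i => LinearMap.proj (R := ℝ)
      (φ := fun _ : Fin (d + 1) => ℝ) 0 '' P i)
      (fun i => (hc i).image (continuous_apply 0)) (fun i => (hP i).linear_image _) ?_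
    · simpa only [Set.image_nonempty] using h1
    intro t
    have h2 := ih (fun i => LinearMap.funLeft ℝ ℝ (Fin.succ : Fin d → Fin (d + 1)) ''
      (P i ∩ {x | x 0 = t}))
      (fun i => ((hc i).inter_right (isClosed_eq (continuous_apply 0) continuous_const)).image
        (LinearMap.continuous_of_finiteDimensional _))
      (fun i => ((hP i).inter ((convex_singleton t).linear_preimage
        (LinearMap.proj (R := ℝ) (φ := fun _ : Fin (d + 1) => ℝ) 0))).linear_image _) ?_
    · rw [← h2]
      refine Finset.sum_congr (Finset.filter_congr fun i _ => ?_) fun _ _ => rfl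
      rw [Set.image_nonempty]
      rfl
    intro y
    rw [← h (Fin.cons t y)]
    refine Finset.sum_congr (Finset.filter_congr fun i _ => ?_) fun _ _ => rfl
    constructor
    · rintro ⟨x, ⟨hx, rfl⟩, rfl⟩
      convert hx
      exact Fin.cons_self_tail x
    · intro hx
      exact ⟨_, ⟨hx, rfl⟩, rfl⟩

/-! ### Valuative functions from completions of a pair -/

namespace LabelledMatroid

variable {r n : ℕ}

theorem ncard_of_isBase (M : LabelledMatroid r n) {B : Set (Fin n)} (hB : M.1.IsBase B) :
    B.ncard = r := by
  have h := hB.encard_eq_eRank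
  rw [M.2.2] at h
  simp [Set.ncard, h]

theorem isCompact_basePolytope (M : LabelledMatroid r n) : IsCompact M.basePolytope := by
  refine Set.Finite.isCompact_convexHull (𝕜 := ℝ) ?_
  refine (Set.finite_range fun B : Set (Fin n) => (B.indicator 1 : Fin n → ℝ)).subset ?_
  rintro x ⟨B, _, rfl⟩
  exact ⟨B, rfl⟩

theorem basePolytope_nonempty (M : LabelledMatroid r n) : M.basePolytope.Nonempty := by
  obtain ⟨B, hB⟩ := M.1.exists_isBase
  exact ⟨_, subset_convexHull ℝ _ ⟨B, hB, rfl⟩⟩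

theorem sum_filter_mem_basePolytope {ι : Type*} [Fintype ι] {a : ι → ℤ}
    {M : ι → LabelledMatroid r n} (h : ∑ i, a i • (M i).polytopeIndicator = 0) (x : Fin n → ℝ) :
    (open Classical in ∑ i with x ∈ (M i).basePolytope, a i) = 0 := by
  classical
  have := congrFun h x
  simpa [polytopeIndicator, Set.indicator_apply, Finset.sum_filter] using this

theorem sum_coeff_eq_zero {ι : Type*} [Fintype ι] {a : ι → ℤ}
    {M : ι → LabelledMatroid r n} (h : ∑ i, a i • (M i).polytopeIndicator = 0) :
    ∑ i, a i = 0 := by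
  classical
  have := sum_filter_nonempty Finset.univ a (fun i => (M i).basePolytope)
    (fun i => (M i).isCompact_basePolytope) (fun i => convex_convexHull ℝ _)
    (sum_filter_mem_basePolytope h)
  simpa [basePolytope_nonempty] using this

/-- The elements that complete `a` and `b` to a base of a matroid of rank three. -/
noncomputable def completions (M : LabelledMatroid 3 n) (a b : Fin n) : Finset (Fin n) :=
  open Classical in {s | M.1.IsBase {a, b, s}}

theorem mem_completions {M : LabelledMatroid 3 n} {a b s : Fin n} :
    s ∈ M.completions a b ↔ M.1.IsBase {a, b, s} := by
  simp [completions]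

theorem sum_le_of_mem_basePolytope (M : LabelledMatroid 3 n) (T : Finset (Fin n))
    (hT : T.card ≤ 3) (hTB : ¬ M.1.IsBase (T : Set (Fin n))) {x : Fin n → ℝ}
    (hx : x ∈ M.basePolytope) : ∑ i ∈ T, x i ≤ 2 := by
  classical
  have hsub : M.basePolytope ⊆ {x | ∑ i ∈ T, x i ≤ 2} := by
    refine convexHull_min ?_ ?_
    · rintro _ ⟨B, hB, rfl⟩
      have h1 : ∑ i ∈ T, (B.indicator 1 : Fin n → ℝ) i = ((T.filter (· ∈ B)).card : ℝ) := by
        simp [Set.indicator_apply]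
      rw [Set.mem_ofPred_eq, h1]
      have h2 : (T.filter (· ∈ B)).card ≤ 2 := by
        by_contra! hlt
        have hle := Finset.card_filter_le T (· ∈ B)
        have heq : T.filter (· ∈ B) = T :=
          Finset.eq_of_subset_of_card_le (Finset.filter_subset _ _) (by omega)
        have hTsub : (T : Set (Fin n)) ⊆ B := fun i hi => (Finset.filter_eq_self.1 heq) i hi
        have : (T : Set (Fin n)) = B := Set.eq_of_subset_of_ncard_le hTsub (by
          rw [M.ncard_of_isBase hB, Set.ncard_coe_finset]; rw [heq] at hlt; omega)
        exact hTB (this ▸ hB)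
      exact_mod_cast h2
    · have := (convex_Iic (2 : ℝ)).linear_preimage
        (∑ i ∈ T, LinearMap.proj (R := ℝ) (φ := fun _ : Fin n => ℝ) i)
      convert this using 1
      ext x
      simp
  exact hsub hx

/-- If some {a, b, s} is not a base, its coordinates sum to at most 2 on the polytope, but to at
least 2 + 1/|S| at this point. Otherwise the point is the average of the vertices {a, b, s}. -/
theorem mem_basePolytope_iff_subset_completions (M : LabelledMatroid 3 n) (a b : Fin n)
    (hab : a ≠ b) (S : Finset (Fin n)) (hS : S.Nonempty) :
    (Pi.single a 1 + Pi.single b 1 + ∑ s ∈ S, (S.card : ℝ)⁻¹ • Pi.single s 1 : Fin n → ℝ) ∈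
      M.basePolytope ↔ S ⊆ M.completions a b := by
  classical
  have hpos : (0 : ℝ) < S.card := by exact_mod_cast hS.card_pos
  constructor
  · intro hx s hs
    rw [mem_completions]
    by_contra hB
    have h1 := M.sum_le_of_mem_basePolytope {a, b, s} Finset.card_le_three
      (by simpa using hB) hx
    have h2 : ∑ i ∈ ({a, b, s} : Finset (Fin n)), (Pi.single a 1 : Fin n → ℝ) i = 1 := by
      simp [Finset.sum_pi_single']
    have h3 : ∑ i ∈ ({a, b, s} : Finset (Fin n)), (Pi.single b 1 : Fin n → ℝ) i = 1 := by
      simp [Finset.sum_pi_single']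
    have h4 : (S.card : ℝ)⁻¹ ≤ ∑ i ∈ ({a, b, s} : Finset (Fin n)),
        (∑ s ∈ S, (S.card : ℝ)⁻¹ • Pi.single s 1 : Fin n → ℝ) i := by
      have hval : ∀ i, (∑ s ∈ S, (S.card : ℝ)⁻¹ • Pi.single s 1 : Fin n → ℝ) i =
          if i ∈ S then (S.card : ℝ)⁻¹ else 0 := by
        intro i
        simp [Finset.sum_apply, Pi.single_apply]
      calc (S.card : ℝ)⁻¹ = (∑ s ∈ S, (S.card : ℝ)⁻¹ • Pi.single s 1 : Fin n → ℝ) s := by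
            rw [hval, if_pos hs]
        _ ≤ _ := Finset.single_le_sum (fun i _ => by rw [hval]; split_ifs <;> positivity)
            (by simp)
    have h5 : 0 < (S.card : ℝ)⁻¹ := inv_pos.2 hpos
    simp only [Pi.add_apply, Finset.sum_add_distrib] at h1
    linarith
  · intro hsub
    have hx : (Pi.single a 1 + Pi.single b 1 + ∑ s ∈ S, (S.card : ℝ)⁻¹ • Pi.single s 1 :
        Fin n → ℝ) = ∑ s ∈ S, (S.card : ℝ)⁻¹ • (({a, b, s} : Set (Fin n)).indicator 1) := by
      have h1 : ∀ s ∈ S, (({a, b, s} : Set (Fin n)).indicator 1 : Fin n → ℝ) =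
          Pi.single a 1 + Pi.single b 1 + Pi.single s 1 := by
        intro s hs
        have hB := mem_completions.1 (hsub hs)
        have hc := M.ncard_of_isBase hB
        have has : a ≠ s := by
          rintro rfl
          have : ({a, b, a} : Set (Fin n)) = {a, b} := by ext; simp; tauto
          rw [this, Set.ncard_pair hab] at hc
          omega
        have hbs : b ≠ s := by
          rintro rfl
          have : ({a, b, b} : Set (Fin n)) = {a, b} := by ext; simp
          rw [this, Set.ncard_pair hab] at hc
          omega
        funext i
        simp only [Set.indicator_apply, Set.mem_insert_iff, Set.mem_singleton_iff, Pi.one_apply,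
          Pi.add_apply, Pi.single_apply]
        by_cases h1 : i = a
        · subst h1; simp [hab, has]
        · by_cases h2 : i = b
          · subst h2; simp [h1, hbs]
          · simp [h1, h2]
      rw [Finset.sum_congr rfl fun s hs => congrArg ((S.card : ℝ)⁻¹ • ·) (h1 s hs)]
      simp only [smul_add, Finset.sum_add_distrib, Finset.sum_const]
      simp only [← Nat.cast_smul_eq_nsmul ℝ, smul_smul, mul_inv_cancel₀ hpos.ne', one_smul]
    rw [hx]
    refine (convex_convexHull ℝ _).sum_mem (fun _ _ => by positivity) ?_ fun s hs =>
      subset_convexHull ℝ _ ⟨_, mem_completions.1 (hsub hs), rfl⟩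
    simp [hpos.ne']

theorem sum_filter_subset_completions {ι : Type*} [Fintype ι] {c : ι → ℤ}
    {M : ι → LabelledMatroid 3 n} (h : ∑ i, c i • (M i).polytopeIndicator = 0) {a b : Fin n}
    (hab : a ≠ b) (S : Finset (Fin n)) : ∑ i with S ⊆ (M i).completions a b, c i = 0 := by
  classical
  rcases S.eq_empty_or_nonempty with rfl | hS
  -- No test point exists for empty S; the Euler characteristic replaces it.
  · simpa using sum_coeff_eq_zero h
  · rw [← sum_filter_mem_basePolytope h (Pi.single a 1 + Pi.single b 1 +
      ∑ s ∈ S, (S.card : ℝ)⁻¹ • Pi.single s 1)]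
    refine Finset.sum_congr (Finset.filter_congr fun i _ => ?_) fun _ _ => rfl
    rw [mem_basePolytope_iff_subset_completions _ _ _ hab _ hS]

theorem sum_filter_completions_eq {ι : Type*} [Fintype ι] {c : ι → ℤ}
    {M : ι → LabelledMatroid 3 n} (h : ∑ i, c i • (M i).polytopeIndicator = 0) {a b : Fin n}
    (hab : a ≠ b) (S : Finset (Fin n)) : ∑ i with (M i).completions a b = S, c i = 0 := by
  classical
  -- Möbius inversion: descending from larger sets, strict supersets contribute zero.
  induction S using WellFoundedGT.induction with
  | ind S ih =>
    have h1 := sum_filter_subset_completions h hab S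
    rw [← Finset.sum_fiberwise_of_maps_to (t := Finset.univ.filter (S ⊆ ·))
      (g := fun i => (M i).completions a b) (fun i hi => by simpa using hi),
      Finset.sum_eq_single S] at h1
    · rw [← h1, Finset.filter_filter]
      refine Finset.sum_congr (Finset.filter_congr fun i _ => ?_) fun _ _ => rfl
      exact ⟨fun h => ⟨h.ge, h⟩, fun h => h.2⟩
    · intro T hT hne
      rw [← ih T (lt_of_le_of_ne (by simpa using hT) hne.symm), Finset.filter_filter]
      refine Finset.sum_congr (Finset.filter_congr fun i _ => ?_) fun _ _ => rfl
      exact ⟨fun h => h.2, fun h => ⟨by simpa [h] using hT, h⟩⟩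
    · intro hS
      simp at hS

/-- Every function of the set of elements completing two fixed elements to a base is
valuative. -/
theorem isValuative_completions {a b : Fin n} (hab : a ≠ b) (g : Finset (Fin n) → ℝ) :
    IsValuative fun M : LabelledMatroid 3 n => g (M.completions a b) := by
  classical
  intro s c M h
  rw [← Finset.sum_fiberwise_of_maps_to (t := Finset.univ)
    (g := fun i => (M i).completions a b) (fun i _ => Finset.mem_univ _)]
  refine Finset.sum_eq_zero fun S _ => ?_
  have hS : ∀ i ∈ Finset.univ.filter (fun i => (M i).completions a b = S),
      c i • g ((M i).completions a b) = c i • g S := fun i hi => by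
    rw [(Finset.mem_filter.1 hi).2]
  rw [Finset.sum_congr rfl hS, ← Finset.sum_smul, sum_filter_completions_eq h hab, zero_smul]

end LabelledMatroid

theorem isValuative_const {r n : ℕ} (x : ℝ) : IsValuative fun _ : LabelledMatroid r n => x := by
  intro s c M h
  rw [← Finset.sum_smul, LabelledMatroid.sum_coeff_eq_zero h, zero_smul]

theorem IsValuative.sum {r n : ℕ} {κ : Type*} {t : Finset κ} {f : κ → LabelledMatroid r n → ℝ}
    (hf : ∀ k ∈ t, IsValuative (f k)) : IsValuative fun M => ∑ k ∈ t, f k M := by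
  intro s c M h
  simp only [Finset.smul_sum]
  rw [Finset.sum_comm]
  exact Finset.sum_eq_zero fun k hk => hf k hk s c M h

theorem IsValuative.sub {r n : ℕ} {f g : LabelledMatroid r n → ℝ} (hf : IsValuative f)
    (hg : IsValuative g) : IsValuative fun M => f M - g M := by
  intro s c M h
  simp only [smul_sub, Finset.sum_sub_distrib, hf s c M h, hg s c M h, sub_zero]

/-! ### Counting lines of size 7 -/

/-- A linear space on 19 points with lines of sizes 3 and 7 only, in which more than 114 ordered
pairs of points span a line of size 7, has a point all of whose lines have size 7. -/
theorem exists_forall_card_line_eq_seven {α : Type*} [Fintype α] [DecidableEq α]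
    (hα : Fintype.card α = 19) (L : α → α → Finset α) (hmem : ∀ a b, a ≠ b → a ∈ L a b)
    (hsymm : ∀ a b, L a b = L b a)
    (hex : ∀ a b c, a ≠ b → c ∈ L a b → c ≠ a → L a c = L a b)
    (hsz : ∀ a b, a ≠ b → (L a b).card = 3 ∨ (L a b).card = 7)
    (hbig : 114 < ∑ a, (Finset.univ.filter fun b => b ≠ a ∧ (L a b).card = 7).card) :
    ∃ u, ∀ b, b ≠ u → (L u b).card = 7 := by
  set N : α → Finset α := fun a => Finset.univ.filter fun b => b ≠ a ∧ (L a b).card = 7 with hN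
  have memN : ∀ a b, b ∈ N a ↔ b ≠ a ∧ (L a b).card = 7 := fun a b => by simp [hN]
  change 114 < ∑ a, (N a).card at hbig
  -- Pigeonhole with 114 = 19 · 6; more than six partners force two 7-lines through u.
  obtain ⟨u, hu⟩ : ∃ u, 6 < (N u).card := by
    by_contra! hle
    have := Finset.sum_le_sum fun a (_ : a ∈ Finset.univ) => hle a
    simp only [Finset.sum_const, Finset.card_univ, hα, smul_eq_mul] at this
    omega
  have hmem' : ∀ a b, a ≠ b → b ∈ L a b := fun a b h => hsymm b a ▸ hmem b a h.symm
  obtain ⟨b₁, hb₁⟩ : (N u).Nonempty := Finset.card_pos.1 (by omega)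
  rw [memN] at hb₁
  obtain ⟨b₂, hb₂, hb₂'⟩ : ∃ b ∈ N u, b ∉ (L u b₁).erase u := by
    apply Finset.exists_mem_notMem_of_card_lt_card
    rw [Finset.card_erase_of_mem (hmem _ _ hb₁.1.symm), hb₁.2]
    exact hu
  rw [memN] at hb₂
  have hne : L u b₁ ≠ L u b₂ := fun h =>
    hb₂' (Finset.mem_erase.2 ⟨hb₂.1, h ▸ hmem' _ _ hb₂.1.symm⟩)
  have fiber : ∀ y, y ≠ u →
      ((Finset.univ.erase u).filter fun x => L u x = L u y) = (L u y).erase u := by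
    intro y hy
    ext x
    simp only [Finset.mem_filter, Finset.mem_erase, Finset.mem_univ, and_true]
    constructor
    · rintro ⟨hx, h⟩
      exact ⟨hx, h ▸ hmem' _ _ hx.symm⟩
    · rintro ⟨hx, h⟩
      exact ⟨hx, hex _ _ _ hy.symm h hx⟩
  set P : Finset (Finset α) := (Finset.univ.erase u).image (L u) with hP
  -- The 18 other points split into blocks of size 2 or 6, at least two of size 6, so 2|P| + 8 ≤ 18.
  have hPcard : P.card ≤ 5 := by
    have h18 : (Finset.univ.erase u).card = 18 := by
      rw [Finset.card_erase_of_mem (Finset.mem_univ _), Finset.card_univ, hα]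
    have hsum := Finset.card_eq_sum_card_fiberwise (f := L u) (s := Finset.univ.erase u) (t := P)
      (fun x hx => Finset.mem_image_of_mem _ hx)
    have hle : ∑ m ∈ P, (2 + (if m = L u b₁ then 4 else 0) + (if m = L u b₂ then 4 else 0)) ≤
        ∑ m ∈ P, ((Finset.univ.erase u).filter fun x => L u x = m).card := by
      refine Finset.sum_le_sum fun m hm => ?_
      obtain ⟨y, hy, rfl⟩ := Finset.mem_image.1 hm
      have hyu := (Finset.mem_erase.1 hy).1
      rw [fiber y hyu, Finset.card_erase_of_mem (hmem _ _ hyu.symm)]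
      split_ifs with h1 h2 h2
      · exact absurd (h1.symm.trans h2) hne
      · rw [h1, hb₁.2]
      · rw [h2, hb₂.2]
      · rcases hsz u y hyu.symm with h | h <;> omega
    rw [← hsum, h18, Finset.sum_add_distrib, Finset.sum_add_distrib, Finset.sum_ite_eq',
      Finset.sum_ite_eq', if_pos (Finset.mem_image_of_mem _ (by simp [hb₁.1])),
      if_pos (Finset.mem_image_of_mem _ (by simp [hb₂.1])), Finset.sum_const, smul_eq_mul] at hle
    omega
  -- A line missing u meets each of the at most five lines through u at most once.
  have through : ∀ a c, a ≠ c → (L a c).card = 7 → u ∈ L a c := by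
    intro a c hac h7
    by_contra hu'
    have hle : (L a c).card ≤ P.card := by
      refine Finset.card_le_card_of_injOn (L u) (fun x hx => Finset.mem_image_of_mem _ ?_) ?_
      · simp only [Finset.mem_erase, Finset.mem_univ, and_true]
        rintro rfl
        exact hu' hx
      · intro x hx y hy hxy
        by_contra hne'
        simp only [Finset.mem_coe] at hx hy
        have hxu : x ≠ u := fun h => hu' (h ▸ hx)
        have hyu : y ≠ u := fun h => hu' (h ▸ hy)
        have h1 : L x y = L a c := by
          by_cases hxa : x = a
          · subst hxa
            exact hex _ _ _ hac hy (Ne.symm hne')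
          · have h2 : L x a = L a c := by rw [hsymm, hex _ _ _ hac hx hxa]
            rw [← h2]
            exact hex _ _ _ hxa (h2 ▸ hy) (Ne.symm hne')
        have h3 : y ∈ L x u := by
          rw [hsymm, hxy]
          exact hmem' _ _ hyu.symm
        have h4 := hex x u y hxu h3 (Ne.symm hne')
        exact hu' (by rw [← h1, h4]; exact hmem' _ _ hxu)
    omega
  refine ⟨u, fun b₀ hb₀ => ?_⟩
  by_contra hb₀'
  -- A short line through u excludes its three points. Every other point lies on at most one 7-line,
  -- the one to u, so the total is at most 16 + 16 · 6 = 112.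
  have hNu : (N u).card ≤ 16 := by
    have hsub : N u ⊆ (L u b₀)ᶜ := by
      intro b hb
      rw [memN] at hb
      rw [Finset.mem_compl]
      intro hbL
      rw [hex _ _ _ hb₀.symm hbL hb.1] at hb
      exact hb₀' hb.2
    have := Finset.card_le_card hsub
    rw [Finset.card_compl, hα] at this
    rcases hsz u b₀ hb₀.symm with h | h <;> omega
  have hNa : ∀ a, a ≠ u → (N a).card ≤ if a ∈ N u then 6 else 0 := by
    intro a ha
    have hline : ∀ b ∈ N a, L a b = L a u := by
      intro b hb
      rw [memN] at hb
      exact (hex _ _ _ hb.1.symm (through a b hb.1.symm hb.2) ha.symm).symm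
    split_ifs with h
    · rw [memN] at h
      have hsub : N a ⊆ (L a u).erase a := by
        intro b hb
        rw [Finset.mem_erase, ← hline b hb]
        exact ⟨((memN _ _).1 hb).1, hmem' _ _ ((memN _ _).1 hb).1.symm⟩
      have := Finset.card_le_card hsub
      rwa [Finset.card_erase_of_mem (hmem _ _ ha), hsymm, h.2] at this
    · rw [Nat.le_zero, Finset.card_eq_zero, Finset.eq_empty_iff_forall_notMem]
      intro b hb
      apply h
      rw [memN, hsymm, ← hline b hb]
      exact ⟨ha, ((memN _ _).1 hb).2⟩
  have hsum : ∑ a, (N a).card ≤ (N u).card + ∑ a, if a ∈ N u then 6 else 0 := by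
    rw [← Finset.add_sum_erase _ _ (Finset.mem_univ u)]
    gcongr
    exact (Finset.sum_le_sum fun a ha => hNa a (Finset.mem_erase.1 ha).1).trans
      (Finset.sum_le_sum_of_subset (Finset.subset_univ _))
  rw [Finset.sum_ite_mem, Finset.univ_inter, Finset.sum_const, smul_eq_mul] at hsum
  omega

/-! ### The additive obstruction -/

/-- A field contains no additive analogue of a Latin square of order six. -/
theorem Finset.not_forall_add_mem_of_card_eq_six {F : Type*} [Field F] {A B C : Finset F}
    (hA : A.card = 6) (hB : B.card = 6) (hC : C.card = 6)
    (h : ∀ a ∈ A, ∀ b ∈ B, a + b ∈ C) : False := by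
  classical
  have hAC : ∀ b ∈ B, A.image (· + b) = C := fun b hb =>
    Finset.eq_of_subset_of_card_le (Finset.image_subset_iff.2 fun a ha => h a ha b hb)
      (by rw [Finset.card_image_of_injective _ (add_left_injective b), hA, hC])
  have himg : ∀ (S : Finset F) (x y : F),
      (S.image (· + x)).image (· + y) = S.image (· + (x + y)) := fun S x y => by
    simp only [Finset.image_image, Function.comp_def, add_assoc]
  have himg0 : ∀ S : Finset F, S.image (· + (0 : F)) = S := fun S => by
    simp only [add_zero, Finset.image_id']
  -- The stabilizer of A under translation satisfies B - b₀ ⊆ H ⊆ A - a₀, hence has order six;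
  -- Cauchy then gives elements of orders 2 and 3.
  let H : AddSubgroup F :=
    { carrier := {x | A.image (· + x) = A}
      zero_mem' := himg0 A
      add_mem' := by
        intro x y hx hy
        simp only [Set.mem_ofPred_eq] at *
        rw [← himg, hx, hy]
      neg_mem' := by
        intro x hx
        simp only [Set.mem_ofPred_eq] at *
        conv_lhs => rw [← hx]
        rw [himg, add_neg_cancel, himg0] }
  obtain ⟨b₀, hb₀⟩ : B.Nonempty := Finset.card_pos.1 (by omega)
  obtain ⟨a₀, ha₀⟩ : A.Nonempty := Finset.card_pos.1 (by omega)
  have hsub : ((B.image (· - b₀) : Finset F) : Set F) ⊆ H := by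
    intro x hx
    obtain ⟨b, hb, rfl⟩ := Finset.mem_image.1 (Finset.mem_coe.1 hx)
    change A.image (· + (b - b₀)) = A
    rw [sub_eq_add_neg, ← himg, hAC b hb, ← hAC b₀ hb₀, himg, add_neg_cancel, himg0]
  have hsup : (H : Set F) ⊆ (A.image (· - a₀) : Finset F) := by
    intro x hx
    have hx' : A.image (· + x) = A := hx
    have : a₀ + x ∈ A := hx' ▸ Finset.mem_image_of_mem _ ha₀
    exact Finset.mem_coe.2 (Finset.mem_image.2 ⟨_, this, by ring⟩)
  have hfin : (H : Set F).Finite := (Finset.finite_toSet _).subset hsup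
  have : Finite H := hfin
  have hcard : Nat.card H = 6 := by
    have h1 := Set.ncard_le_ncard hsub hfin
    have h2 := Set.ncard_le_ncard hsup (Finset.finite_toSet _)
    rw [Set.ncard_coe_finset, Finset.card_image_of_injective _ sub_left_injective] at h1 h2
    have h3 : Nat.card H = (H : Set F).ncard := rfl
    omega
  obtain ⟨x, hx⟩ := exists_prime_addOrderOf_dvd_card' (G := H) 2 (by rw [hcard]; norm_num)
  obtain ⟨y, hy⟩ := exists_prime_addOrderOf_dvd_card' (G := H) 3 (by rw [hcard]; norm_num)
  have hx0 : (x : F) ≠ 0 := by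
    intro h0
    have : x = 0 := Subtype.ext h0
    rw [this, addOrderOf_zero] at hx
    omega
  have hy0 : (y : F) ≠ 0 := by
    intro h0
    have : y = 0 := Subtype.ext h0
    rw [this, addOrderOf_zero] at hy
    omega
  have hx2 : (2 : F) * x = 0 := by
    have := congrArg (Subtype.val) (addOrderOf_nsmul_eq_zero x)
    rw [hx] at this
    simpa using this
  have hy3 : (3 : F) * y = 0 := by
    have := congrArg (Subtype.val) (addOrderOf_nsmul_eq_zero y)
    rw [hy] at this
    simpa using this
  have h2 := (mul_eq_zero.1 hx2).resolve_right hx0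
  have h3 := (mul_eq_zero.1 hy3).resolve_right hy0
  exact one_ne_zero (by linear_combination h3 - h2 : (1 : F) = 0)

/-! ### Coordinates for the Latin square -/

section Lines

variable {F V ι : Type*} [Field F] [AddCommGroup V] [Module F V] {v : ι → V}
  {L : ι → ι → Finset ι}

theorem line_exchange (hpair : ∀ a b, a ≠ b → LinearIndependent F ![v a, v b])
    (hL : ∀ a b, a ≠ b → ∀ s, s ∈ L a b ↔ v s ∈ Submodule.span F {v a, v b})
    (a b c : ι) (hab : a ≠ b) (hc : c ∈ L a b) (hca : c ≠ a) : L a c = L a b := by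
  have hc' := (hL a b hab c).1 hc
  have hb : v b ∈ Submodule.span F {v a, v c} := by
    rw [Set.pair_comm] at hc' ⊢
    refine mem_span_insert_exchange hc' fun h => ?_
    obtain ⟨x, hx⟩ := Submodule.mem_span_singleton.1 h
    have := LinearIndependent.pair_iff.1 (hpair a c hca.symm) x (-1) (by rw [hx]; simp)
    simp at this
  have hspan : Submodule.span F {v a, v c} = Submodule.span F {v a, v b} := by
    apply le_antisymm <;> rw [Submodule.span_le] <;> rintro x (rfl | rfl)
    · exact Submodule.subset_span (by simp)
    · exact hc'
    · exact Submodule.subset_span (by simp)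
    · exact hb
  ext s
  rw [hL a b hab, hL a c hca.symm, hspan]

theorem exists_eq_smul_add_smul_of_mem_line
    (hpair : ∀ a b, a ≠ b → LinearIndependent F ![v a, v b])
    (hL : ∀ a b, a ≠ b → ∀ s, s ∈ L a b ↔ v s ∈ Submodule.span F {v a, v b})
    {a b c : ι} (hab : a ≠ b) (hc : c ∈ L a b) (hca : c ≠ a) :
    ∃ x y : F, y ≠ 0 ∧ v c = x • v a + y • v b := by
  obtain ⟨x, y, h⟩ := Submodule.mem_span_pair.1 ((hL a b hab c).1 hc)
  refine ⟨x, y, ?_, h.symm⟩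
  rintro rfl
  have := LinearIndependent.pair_iff.1 (hpair a c hca.symm) x (-1) (by rw [← h]; simp)
  simp at this

/-- Nineteen points in a vector space over a field cannot form three concurrent lines of size
seven together with a Latin square of order six. -/
theorem not_forall_card_line_eq_seven [Fintype ι] [DecidableEq ι] (hι : Fintype.card ι = 19)
    (hpair : ∀ a b, a ≠ b → LinearIndependent F ![v a, v b])
    (hL : ∀ a b, a ≠ b → ∀ s, s ∈ L a b ↔ v s ∈ Submodule.span F {v a, v b})
    (hsz : ∀ a b, a ≠ b → 3 ≤ (L a b).card) (u : ι) (hu : ∀ b, b ≠ u → (L u b).card = 7) :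
    False := by
  classical
  have hex := line_exchange hpair hL
  have hmem : ∀ a b, a ≠ b → a ∈ L a b := fun a b h =>
    (hL a b h a).2 (Submodule.subset_span (by simp))
  have hmem' : ∀ a b, a ≠ b → b ∈ L a b := fun a b h =>
    (hL a b h b).2 (Submodule.subset_span (by simp))
  have hsymm : ∀ a b, a ≠ b → L a b = L b a := fun a b h => by
    ext s
    rw [hL a b h, hL b a h.symm, Set.pair_comm]
  obtain ⟨b₁, hb₁⟩ : ∃ b₁, b₁ ∉ ({u} : Finset ι) := by
    by_contra! hall
    have := Finset.card_le_card (fun x _ => hall x : Finset.univ ⊆ {u})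
    rw [Finset.card_univ, hι, Finset.card_singleton] at this
    omega
  replace hb₁ : b₁ ≠ u := by simpa using hb₁
  obtain ⟨b₂, hb₂⟩ : ∃ b₂, b₂ ∉ L u b₁ := by
    by_contra! hall
    have := Finset.card_le_card (fun x _ => hall x : Finset.univ ⊆ L u b₁)
    rw [Finset.card_univ, hι, hu _ hb₁] at this
    omega
  have hb₂u : b₂ ≠ u := fun h => hb₂ (by rw [h]; exact hmem _ _ hb₁.symm)
  obtain ⟨b₃, hb₃⟩ : ∃ b₃, b₃ ∉ L u b₁ ∪ L u b₂ := by
    by_contra! hall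
    have := Finset.card_le_card (fun x _ => hall x : Finset.univ ⊆ L u b₁ ∪ L u b₂)
    have h2 := Finset.card_union_le (L u b₁) (L u b₂)
    rw [Finset.card_univ, hι] at this
    rw [hu _ hb₁, hu _ hb₂u] at h2
    omega
  rw [Finset.mem_union, not_or] at hb₃
  have hb₃u : b₃ ≠ u := fun h => hb₃.1 (by rw [h]; exact hmem _ _ hb₁.symm)
  have mem_trans : ∀ x y w, x ≠ u → y ≠ u → w ≠ u → x ∈ L u y → x ∈ L u w → w ∈ L u y := by
    intro x y w hx hy hw hxy hxw
    rw [← hex _ _ _ hy.symm hxy hx, hex _ _ _ hw.symm hxw hx]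
    exact hmem' _ _ hw.symm
  have hdisj : ∀ y w, y ≠ u → w ≠ u → w ∉ L u y →
      Disjoint ((L u y).erase u) ((L u w).erase u) := by
    intro y w hy hw hwy
    rw [Finset.disjoint_left]
    intro x hx hx'
    rw [Finset.mem_erase] at hx hx'
    exact hwy (mem_trans x y w hx.1 hy hw hx.2 hx'.2)
  have hcard : ∀ y, y ≠ u → ((L u y).erase u).card = 6 := fun y hy => by
    rw [Finset.card_erase_of_mem (hmem _ _ hy.symm), hu y hy]
  have hcover : ∀ x, x ≠ u → x ∈ L u b₁ ∨ x ∈ L u b₂ ∨ x ∈ L u b₃ := by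
    intro x hx
    have hcardU : (((L u b₁).erase u ∪ (L u b₂).erase u) ∪ (L u b₃).erase u).card = 18 := by
      rw [Finset.card_union_of_disjoint, Finset.card_union_of_disjoint (hdisj _ _ hb₁ hb₂u hb₂),
        hcard _ hb₁, hcard _ hb₂u, hcard _ hb₃u]
      exact Finset.disjoint_union_left.2 ⟨hdisj _ _ hb₁ hb₃u hb₃.1, hdisj _ _ hb₂u hb₃u hb₃.2⟩
    have hsub : ((L u b₁).erase u ∪ (L u b₂).erase u) ∪ (L u b₃).erase u ⊆
        Finset.univ.erase u := by
      intro y hy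
      simp only [Finset.mem_union, Finset.mem_erase, Finset.mem_univ, and_true] at hy ⊢
      tauto
    have heq := Finset.eq_of_subset_of_card_le hsub (by
      rw [hcardU, Finset.card_erase_of_mem (Finset.mem_univ _), Finset.card_univ, hι])
    have hxu : x ∈ Finset.univ.erase u := by simpa using hx
    rw [← heq] at hxu
    simp only [Finset.mem_union, Finset.mem_erase] at hxu
    tauto
  -- The line ab misses u, so it meets the first two 7-lines only in a and b; its third point falls
  -- on the last one.
  have third : ∀ a ∈ (L u b₁).erase u, ∀ b ∈ (L u b₂).erase u,
      ∃ c ∈ (L u b₃).erase u, c ∈ L a b := by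
    intro a ha b hb
    have hab : a ≠ b := fun h =>
      Finset.disjoint_left.1 (hdisj _ _ hb₁ hb₂u hb₂) ha (h ▸ hb)
    rw [Finset.mem_erase] at ha hb
    have hLa : L u a = L u b₁ := hex _ _ _ hb₁.symm ha.2 ha.1
    have hLb : L u b = L u b₂ := hex _ _ _ hb₂u.symm hb.2 hb.1
    obtain ⟨c, hc, hc'⟩ : ∃ c ∈ L a b, c ∉ ({a, b} : Finset ι) := by
      apply Finset.exists_mem_notMem_of_card_lt_card
      have h1 := hsz a b hab
      have h2 := Finset.card_le_two (a := a) (b := b)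
      omega
    simp only [Finset.mem_insert, Finset.mem_singleton, not_or] at hc'
    have hLac : L a c = L a b := hex _ _ _ hab hc hc'.1
    have hLbc : L b c = L b a := hex _ _ _ hab.symm (hsymm a b hab ▸ hc) hc'.2
    have huab : u ∉ L a b := by
      intro h
      refine Finset.disjoint_left.1 (hdisj _ _ hb₁ hb₂u hb₂) (?_ : b ∈ _) (by simpa using hb)
      rw [Finset.mem_erase, ← hLa, hsymm _ _ ha.1.symm, hex _ _ _ hab h ha.1.symm]
      exact ⟨hb.1, hmem' _ _ hab⟩
    have hcu : c ≠ u := fun h => huab (h ▸ hc)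
    refine ⟨c, Finset.mem_erase.2 ⟨hcu, ?_⟩, hc⟩
    rcases hcover c hcu with h | h | h
    · refine absurd ?_ huab
      rw [← hLac]
      rw [← hLa, hsymm _ _ ha.1.symm] at h
      rw [hex _ _ _ ha.1 h hc'.1]
      exact hmem' _ _ ha.1
    · refine absurd ?_ huab
      rw [hsymm _ _ hab, ← hLbc]
      rw [← hLb, hsymm _ _ hb.1.symm] at h
      rw [hex _ _ _ hb.1 h hc'.2]
      exact hmem' _ _ hb.1
    · exact h
  have hb₁₂ : b₁ ≠ b₂ := fun h => hb₂ (h ▸ hmem' _ _ hb₁.symm)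
  have hb₁E : b₁ ∈ (L u b₁).erase u := Finset.mem_erase.2 ⟨hb₁, hmem' _ _ hb₁.symm⟩
  have hb₂E : b₂ ∈ (L u b₂).erase u := Finset.mem_erase.2 ⟨hb₂u, hmem' _ _ hb₂u.symm⟩
  obtain ⟨c₀, hc₀E, hc₀⟩ := third b₁ hb₁E b₂ hb₂E
  have hc₀1 : c₀ ≠ b₁ := fun h =>
    Finset.disjoint_left.1 (hdisj _ _ hb₁ hb₃u hb₃.1) hb₁E (h ▸ hc₀E)
  have hc₀2 : c₀ ≠ b₂ := fun h =>
    Finset.disjoint_left.1 (hdisj _ _ hb₂u hb₃u hb₃.2) hb₂E (h ▸ hc₀E)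
  rw [Finset.mem_erase] at hc₀E
  have hLc₀ : L u c₀ = L u b₃ := hex _ _ _ hb₃u.symm hc₀E.2 hc₀E.1
  -- In the frame `v u`, `s • v b₁`, `t • v b₂`, the vector of c₀ is the sum of the last two. Each
  -- point on the three lines is then a base vector plus a multiple of `v u`, up to scale, and
  -- collinearity reads α + β = γ.
  obtain ⟨s, t, ht, hst⟩ := exists_eq_smul_add_smul_of_mem_line hpair hL hb₁₂ hc₀ hc₀1
  have hs : s ≠ 0 := by
    rintro rfl
    have := LinearIndependent.pair_iff.1 (hpair _ _ hc₀2) 1 (-t) (by rw [hst]; simp)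
    simp at this
  have hind : ∀ x y w : F, x • v u + y • (s • v b₁) + w • (t • v b₂) = 0 →
      x = 0 ∧ y = 0 ∧ w = 0 := by
    intro x y w h
    have hw : w = 0 := by
      by_contra hw
      apply hb₂
      rw [hL _ _ hb₁.symm, Submodule.mem_span_pair]
      refine ⟨-(w * t)⁻¹ * x, -(w * t)⁻¹ * (y * s), ?_⟩
      have h1 : v b₂ = (w * t)⁻¹ • (w • (t • v b₂)) := by
        rw [smul_smul w t, inv_smul_smul₀ (mul_ne_zero hw ht)]
      rw [h1, ← neg_eq_of_add_eq_zero_right h]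
      module
    subst hw
    have := LinearIndependent.pair_iff.1 (hpair _ _ hb₁.symm) x (y * s)
      (by rw [← h]; module)
    exact ⟨this.1, (mul_eq_zero.1 this.2).resolve_right hs, rfl⟩
  have coords : ∀ (y : ι) (r : F) (w : V), y ≠ u → r ≠ 0 → w = r • v y → ∀ a,
      a ∈ (L u y).erase u → ∃ α k : F, k ≠ 0 ∧ v a = k • (w + α • v u) := by
    rintro y r _ hy hr rfl a ha
    rw [Finset.mem_erase] at ha
    obtain ⟨x, m, hm, h⟩ := exists_eq_smul_add_smul_of_mem_line hpair hL hy.symm ha.2 ha.1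
    refine ⟨r * m⁻¹ * x, m * r⁻¹, mul_ne_zero hm (inv_ne_zero hr), ?_⟩
    rw [h, smul_add, smul_smul, smul_smul, inv_mul_cancel_right₀ hr, add_comm]
    congr 2
    field_simp
  have inj : ∀ (E : Finset ι) (w : V) (α k : ι → F),
      (∀ a ∈ E, k a ≠ 0 ∧ v a = k a • (w + α a • v u)) → (E.image α).card = E.card := by
    intro E w α k h
    refine Finset.card_image_of_injOn fun a ha b hb hab => ?_
    by_contra hne
    have := LinearIndependent.pair_iff.1 (hpair _ _ hne) (k b) (-k a) (by
      rw [(h a ha).2, (h b hb).2, hab]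
      module)
    exact (h b hb).1 this.1
  choose! α k hα using coords b₁ s _ hb₁ hs rfl
  choose! β l hβ using coords b₂ t _ hb₂u ht rfl
  choose! γ m hγ using coords c₀ 1 _ hc₀E.1 one_ne_zero rfl
  refine Finset.not_forall_add_mem_of_card_eq_six
    (A := ((L u b₁).erase u).image α) (B := ((L u b₂).erase u).image β)
    (C := ((L u c₀).erase u).image γ)
    (by rw [inj _ _ α k hα, hcard _ hb₁]) (by rw [inj _ _ β l hβ, hcard _ hb₂u])
    (by rw [inj _ _ γ m hγ, hcard _ hc₀E.1]) ?_
  intro _ hA _ hB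
  obtain ⟨a, ha, rfl⟩ := Finset.mem_image.1 hA
  obtain ⟨b, hb, rfl⟩ := Finset.mem_image.1 hB
  obtain ⟨c, hc, hcab⟩ := third a ha b hb
  rw [← hLc₀] at hc
  refine Finset.mem_image.2 ⟨c, hc, ?_⟩
  have hab : a ≠ b := fun h =>
    Finset.disjoint_left.1 (hdisj _ _ hb₁ hb₂u hb₂) ha (h ▸ hb)
  obtain ⟨x, y, hxy⟩ := Submodule.mem_span_pair.1 ((hL _ _ hab c).1 hcab)
  rw [(hα a ha).2, (hβ b hb).2, (hγ c hc).2, hst, one_smul] at hxy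
  obtain ⟨h1, h2, h3⟩ := hind (x * k a * α a + y * l b * β b - m c * γ c) (x * k a - m c)
    (y * l b - m c) (by rw [← sub_eq_zero] at hxy; rw [← hxy]; module)
  have hm := (hγ c hc).1
  apply mul_left_cancel₀ hm
  linear_combination (-1 : F) * h1 + α a * h2 + β b * h3

end Lines

/-! ### The invariant and its sign on representable matroids -/

/-- The weight of an ordered pair of points spanning a line of size `k`. -/
noncomputable def lineWeight (k : ℕ) : ℝ :=
  -- One pair of any other size already cancels the 228 subtracted in `latinDefect`. Dependent pairs
  -- on 19 points count as size 19.
  if k = 7 then 0 else if k = 3 then 1 else 228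

theorem lineWeight_nonneg (k : ℕ) : 0 ≤ lineWeight k := by
  unfold lineWeight
  split_ifs <;> norm_num

namespace LabelledMatroid

variable {n : ℕ}

/-- The total weight of all pairs of distinct points, minus 228. -/
noncomputable def latinDefect (M : LabelledMatroid 3 n) : ℝ :=
  ∑ p ∈ Finset.univ.offDiag, lineWeight (M.completions p.1 p.2)ᶜ.card - 228

theorem isValuative_latinDefect : IsValuative (latinDefect (n := n)) :=
  (IsValuative.sum fun _ hp => isValuative_completions (Finset.mem_offDiag.1 hp).2.2
    fun S => lineWeight Sᶜ.card).sub (isValuative_const 228)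

theorem latinDefect_eq_of_iso {M N : LabelledMatroid 3 n} (h : M.Iso N) :
    M.latinDefect = N.latinDefect := by
  obtain ⟨σ, hσ⟩ := h
  have hc : ∀ a b, N.completions (σ a) (σ b) = (M.completions a b).map σ.toEmbedding := by
    intro a b
    ext s
    rw [Finset.mem_map_equiv, mem_completions, mem_completions, hσ, Matroid.mapEquiv_isBase_iff]
    simp [Set.image_insert_eq]
  unfold latinDefect
  congr 1
  refine Finset.sum_equiv (σ.prodCongr σ) (by simp) fun p _ => ?_
  simp [hc, Finset.card_compl]

theorem isBase_iff_indep_ncard {r : ℕ} (M : LabelledMatroid r n) (B : Set (Fin n)) :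
    M.1.IsBase B ↔ M.1.Indep B ∧ B.ncard = r := by
  refine ⟨fun h => ⟨h.indep, M.ncard_of_isBase h⟩, fun ⟨h, hr⟩ => ?_⟩
  obtain ⟨B', hB', hsub⟩ := h.exists_isBase_superset
  rwa [Set.eq_of_subset_of_ncard_le hsub (by rw [M.ncard_of_isBase hB', hr])]

theorem isBase_triple_iff {M : LabelledMatroid 3 n} {F V : Type*} [Field F] [AddCommGroup V]
    [Module F V] {v : Fin n → V} (hv : ∀ I, M.1.Indep I ↔ LinearIndepOn F v I) {a b : Fin n}
    (hab : a ≠ b) (hpair : LinearIndepOn F v {a, b}) (s : Fin n) :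
    M.1.IsBase {a, b, s} ↔ v s ∉ Submodule.span F {v a, v b} := by
  have hset : ({a, b, s} : Set (Fin n)) = insert s {a, b} := by
    ext x
    simp only [Set.mem_insert_iff, Set.mem_singleton_iff]
    tauto
  rw [isBase_iff_indep_ncard, hset, hv, linearIndepOn_insert_iff, Set.image_pair]
  by_cases hs : s ∈ ({a, b} : Set (Fin n))
  · have h1 : v s ∈ Submodule.span F {v a, v b} := by
      refine Submodule.subset_span ?_
      rw [← Set.image_pair]
      exact Set.mem_image_of_mem v hs
    rw [Set.insert_eq_of_mem hs, Set.ncard_pair hab]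
    simp [h1]
  · rw [Set.ncard_insert_of_notMem hs, Set.ncard_pair hab]
    simp [hs, hpair]

theorem latinDefect_nonneg_of_isRepresentableOver (M : LabelledMatroid 3 19) {F : Type u}
    [Field F] (hM : M.IsRepresentableOver F) : 0 ≤ M.latinDefect := by
  obtain ⟨m, A, hA⟩ := hM
  by_contra! hneg
  unfold latinDefect at hneg
  have hsz : ∀ a b, a ≠ b →
      (M.completions a b)ᶜ.card = 3 ∨ (M.completions a b)ᶜ.card = 7 := by
    intro a b hab
    by_contra! hne
    have h1 := Finset.single_le_sum (f := fun p : Fin 19 × Fin 19 =>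
      lineWeight (M.completions p.1 p.2)ᶜ.card) (fun p _ => lineWeight_nonneg _)
      (show (a, b) ∈ Finset.univ.offDiag by simp [hab])
    simp only [lineWeight, if_neg hne.1, if_neg hne.2] at h1 hneg
    linarith
  have hindep : ∀ a b, a ≠ b → LinearIndepOn F A.col {a, b} := by
    intro a b hab
    have h1 := Finset.card_compl_add_card (M.completions a b)
    rw [Fintype.card_fin] at h1
    obtain ⟨s, hs⟩ : (M.completions a b).Nonempty :=
      Finset.card_pos.1 (by rcases hsz a b hab with h | h <;> omega)
    refine ((hA _).1 (mem_completions.1 hs).indep).mono ?_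
    rintro x (rfl | rfl) <;> simp
  have hpair : ∀ a b, a ≠ b → LinearIndependent F ![A.col a, A.col b] := fun a b hab =>
    LinearIndependent.pair_iff.2 ((LinearIndepOn.pair_iff _ hab).1 (hindep a b hab))
  have hL : ∀ a b, a ≠ b → ∀ s, s ∈ (M.completions a b)ᶜ ↔
      A.col s ∈ Submodule.span F {A.col a, A.col b} := by
    intro a b hab s
    rw [Finset.mem_compl, mem_completions, isBase_triple_iff hA hab (hindep a b hab), not_not]
  have hbig : 114 < ∑ a : Fin 19,
      (Finset.univ.filter fun b => b ≠ a ∧ (M.completions a b)ᶜ.card = 7).card := by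
    -- With sizes 3 and 7 only, the weight counts pairs not on a 7-line.
    have h1 : ∀ a : Fin 19, (∑ b ∈ Finset.univ.erase a,
        lineWeight (M.completions a b)ᶜ.card) = 18 -
        ((Finset.univ.filter fun b => b ≠ a ∧ (M.completions a b)ᶜ.card = 7).card : ℝ) := by
      intro a
      have h2 : ∀ b ∈ Finset.univ.erase a, lineWeight (M.completions a b)ᶜ.card =
          1 - if (M.completions a b)ᶜ.card = 7 then 1 else 0 := by
        intro b hb
        rcases hsz a b (Finset.mem_erase.1 hb).1.symm with h | h <;> simp [lineWeight, h]
      rw [Finset.sum_congr rfl h2, Finset.sum_sub_distrib, Finset.sum_boole, Finset.sum_const,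
        Finset.card_erase_of_mem (Finset.mem_univ a), Finset.card_univ, Fintype.card_fin]
      congr 2
      · norm_num
      · congr 1
        ext b
        simp
    have h3 : ∑ p ∈ Finset.univ.offDiag, lineWeight (M.completions p.1 p.2)ᶜ.card =
        ∑ a : Fin 19, ∑ b ∈ Finset.univ.erase a, lineWeight (M.completions a b)ᶜ.card :=
      Finset.sum_finset_product _ Finset.univ (fun a => Finset.univ.erase a)
        fun p => by simp [eq_comm]
    rw [h3, Finset.sum_congr rfl fun a _ => h1 a, Finset.sum_sub_distrib] at hneg
    simp only [Finset.sum_const, Finset.card_univ, Fintype.card_fin, nsmul_eq_mul] at hneg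
    have h4 : (114 : ℝ) < ∑ a : Fin 19,
        ((Finset.univ.filter fun b => b ≠ a ∧ (M.completions a b)ᶜ.card = 7).card : ℝ) := by
      norm_num at hneg
      linarith
    exact_mod_cast h4
  have hsymm : ∀ a b, (M.completions a b)ᶜ = (M.completions b a)ᶜ := by
    intro a b
    ext s
    rw [Finset.mem_compl, Finset.mem_compl, mem_completions, mem_completions, Set.insert_comm]
  obtain ⟨u, hu⟩ := exists_forall_card_line_eq_seven (Fintype.card_fin 19)
    (fun a b => (M.completions a b)ᶜ)
    (fun a b hab => (hL a b hab a).2 (Submodule.subset_span (by simp)))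
    hsymm (line_exchange hpair hL) hsz hbig
  exact not_forall_card_line_eq_seven (Fintype.card_fin 19) hpair hL
    (fun a b hab => by rcases hsz a b hab with h | h <;> omega) u hu

-- The matroid of the cyclic Latin square

end LabelledMatroid

/-- A label for the line through two distinct points of the following configuration. The point
`18` lies on three lines of size seven, the residue classes modulo three of the remaining points.
Three points `3 x`, `3 y + 1`, `3 z + 2` are collinear if `x + y + z` is divisible by six. -/
def latinLine (a b : Fin 19) : ℕ :=
  if a.1 = 18 then b.1 % 3
  else if b.1 = 18 then a.1 % 3
  else match a.1 % 3, b.1 % 3 with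
    -- Short lines are labelled by their indices in classes 0 and 1, a missing index being minus the
    -- sum of the other two modulo six; starting from 12 prevents truncated subtraction.
    | 0, 1 => 3 + 6 * (a.1 / 3) + b.1 / 3
    | 1, 0 => 3 + 6 * (b.1 / 3) + a.1 / 3
    | 0, 2 => 3 + 6 * (a.1 / 3) + (12 - a.1 / 3 - b.1 / 3) % 6
    | 2, 0 => 3 + 6 * (b.1 / 3) + (12 - a.1 / 3 - b.1 / 3) % 6
    | 1, 2 => 3 + 6 * ((12 - a.1 / 3 - b.1 / 3) % 6) + a.1 / 3
    | 2, 1 => 3 + 6 * ((12 - a.1 / 3 - b.1 / 3) % 6) + b.1 / 3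
    | i, _ => i

theorem latinLine_comm (a b : Fin 19) : latinLine a b = latinLine b a := by
  revert a b
  decide +kernel

theorem latinLine_trans (a b c : Fin 19) (hab : a ≠ b) (hac : a ≠ c) (hbc : b ≠ c)
    (h : latinLine a b = latinLine a c) : latinLine b c = latinLine a b := by
  revert a b c
  decide +kernel

/-- The bases of the matroid of the configuration `latinLine`. -/
def IsLatinBase (B : Set (Fin 19)) : Prop :=
  ∃ a b c, a ≠ b ∧ a ≠ c ∧ b ≠ c ∧ latinLine a b ≠ latinLine a c ∧ B = {a, b, c}

theorem isLatinBase_triple_iff {a b c : Fin 19} (hab : a ≠ b) (hac : a ≠ c) (hbc : b ≠ c) :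
    IsLatinBase {a, b, c} ↔ latinLine a b ≠ latinLine a c := by
  refine ⟨?_, fun h => ⟨a, b, c, hab, hac, hbc, h, rfl⟩⟩
  rintro ⟨x, y, z, hxy, hxz, -, hne, heq⟩ h
  have hline : ∀ x ∈ ({a, b, c} : Set (Fin 19)), ∀ y ∈ ({a, b, c} : Set (Fin 19)), x ≠ y →
      latinLine x y = latinLine a b := by
    have h1 := latinLine_trans a b c hab hac hbc h
    rintro x (rfl | rfl | rfl) y (rfl | rfl | rfl) hxy
    exacts [absurd rfl hxy, rfl, h.symm, latinLine_comm _ _, absurd rfl hxy, h1,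
      (latinLine_comm _ _).trans h.symm, (latinLine_comm _ _).trans h1, absurd rfl hxy]
  rw [heq] at hline
  exact hne ((hline x (by simp) y (by simp) hxy).trans (hline x (by simp) z (by simp) hxz).symm)

theorem IsLatinBase.exists_eq_triple {B : Set (Fin 19)} (hB : IsLatinBase B) {e : Fin 19}
    (he : e ∈ B) : ∃ p q, e ≠ p ∧ e ≠ q ∧ p ≠ q ∧ B = {e, p, q} := by
  obtain ⟨a, b, c, hab, hac, hbc, -, rfl⟩ := hB
  rcases he with rfl | rfl | rfl
  · exact ⟨b, c, hab, hac, hbc, rfl⟩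
  · exact ⟨a, c, hab.symm, hbc, hac, Set.insert_comm _ _ _⟩
  · exact ⟨a, b, hac.symm, hbc.symm, hab, by ext; simp; tauto⟩

/-- If no element of Y could replace e, all of Y would lie on the line of the two remaining points p
and q, so Y would not be a base. -/
theorem exchangeProperty_isLatinBase : Matroid.ExchangeProperty IsLatinBase := by
  rintro X Y hX ⟨a, b, c, hab, hac, -, hne, rfl⟩ e ⟨heX, heY⟩
  obtain ⟨p, q, hep, heq, hpq, rfl⟩ := hX.exists_eq_triple heX
  by_contra! hcon
  have hall : ∀ f ∈ ({a, b, c} : Set (Fin 19)), f = p ∨ latinLine p f = latinLine p q := by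
    intro f hf
    by_contra! hf'
    have hfe : f ≠ e := fun h => heY (h ▸ hf)
    have hfq : f ≠ q := fun h => hf'.2 (by rw [h])
    refine hcon f ⟨hf, by simp [hfe, hf'.1, hfq]⟩ ?_
    have hset : insert f (({e, p, q} : Set (Fin 19)) \ {e}) = {p, q, f} := by
      ext x
      simp only [Set.mem_insert_iff, Set.mem_sdiff, Set.mem_singleton_iff]
      constructor
      · tauto
      · rintro (rfl | rfl | rfl)
        · exact Or.inr ⟨by simp, hep.symm⟩
        · exact Or.inr ⟨by simp, heq.symm⟩
        · exact Or.inl rfl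
    rw [hset, isLatinBase_triple_iff hpq (Ne.symm hf'.1) (Ne.symm hfq)]
    exact Ne.symm hf'.2
  have hline : ∀ x ∈ ({a, b, c} : Set (Fin 19)), ∀ y ∈ ({a, b, c} : Set (Fin 19)), x ≠ y →
      latinLine x y = latinLine p q := by
    intro x hx y hy hxy
    by_cases hxp : x = p
    · subst hxp
      exact (hall y hy).resolve_left hxy.symm
    · by_cases hyp : y = p
      · subst hyp
        exact (latinLine_comm _ _).trans ((hall x hx).resolve_left hxy)
      · have h1 := (hall x hx).resolve_left hxp
        have h2 := (hall y hy).resolve_left hyp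
        rw [latinLine_trans p x y (Ne.symm hxp) (Ne.symm hyp) hxy (h1.trans h2.symm), h1]
  exact hne ((hline a (by simp) b (by simp) hab).trans (hline a (by simp) c (by simp) hac).symm)

theorem exists_isLatinBase : ∃ B, IsLatinBase B :=
  ⟨_, 0, 1, 3, by decide, by decide, by decide, by decide, rfl⟩

/-- The matroid of three concurrent lines of size seven whose remaining points are connected by
the addition table of the integers modulo six. -/
def latinMatroid : LabelledMatroid 3 19 :=
  ⟨Matroid.ofIsBaseOfFinite Set.finite_univ IsLatinBase exists_isLatinBase
    exchangeProperty_isLatinBase fun _ _ => Set.subset_univ _, rfl, by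
    obtain ⟨B, hB⟩ := exists_isLatinBase
    rw [← Matroid.IsBase.encard_eq_eRank (B := B) (by simpa using hB)]
    obtain ⟨a, b, c, hab, hac, hbc, -, rfl⟩ := hB
    rw [Set.encard_eq_three.2 ⟨a, b, c, hab, hac, hbc, rfl⟩]
    rfl⟩

/-- The points on the line through two points of `latinLine`. -/
def latinPoints (a b : Fin 19) : Finset (Fin 19) :=
  {s | s = a ∨ s = b ∨ latinLine a b = latinLine a s}

theorem compl_completions_latinMatroid {a b : Fin 19} (hab : a ≠ b) :
    (latinMatroid.completions a b)ᶜ = latinPoints a b := by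
  ext s
  have hbase : latinMatroid.1.IsBase = IsLatinBase := rfl
  rw [Finset.mem_compl, LabelledMatroid.mem_completions, hbase]
  simp only [latinPoints, Finset.mem_filter, Finset.mem_univ, true_and]
  by_cases hs : s = a ∨ s = b
  · have hnb : ¬ IsLatinBase {a, b, s} := by
      intro h
      have hc := LabelledMatroid.ncard_of_isBase latinMatroid (hbase ▸ h)
      have hset : ({a, b, s} : Set (Fin 19)) = {a, b} := by
        rcases hs with rfl | rfl <;> ext <;> simp; tauto
      rw [hset, Set.ncard_pair hab] at hc
      omega
    tauto
  · rw [not_or] at hs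
    rw [isLatinBase_triple_iff hab (Ne.symm hs.1) (Ne.symm hs.2)]
    tauto

theorem card_latinPoints (a b : Fin 19) (hab : a ≠ b) :
    (latinPoints a b).card = 3 ∨ (latinPoints a b).card = 7 := by
  revert a b
  decide +kernel

/-- There are 36 short lines with six ordered pairs each. -/
theorem card_filter_card_latinPoints :
    ((Finset.univ.offDiag.filter fun p : Fin 19 × Fin 19 =>
      (latinPoints p.1 p.2).card = 3).card) = 216 := by
  decide +kernel

theorem latinDefect_latinMatroid : latinMatroid.latinDefect = -12 := by
  have h : ∀ p ∈ (Finset.univ.offDiag : Finset (Fin 19 × Fin 19)),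
      lineWeight (latinMatroid.completions p.1 p.2)ᶜ.card =
        if (latinPoints p.1 p.2).card = 3 then 1 else 0 := by
    intro p hp
    have hne := (Finset.mem_offDiag.1 hp).2.2
    rw [compl_completions_latinMatroid hne]
    rcases card_latinPoints _ _ hne with h | h <;> simp [lineWeight, h]
  rw [LabelledMatroid.latinDefect, Finset.sum_congr rfl h, Finset.sum_boole,
    card_filter_card_latinPoints]
  norm_num

theorem theorem6p1 :
    ∃ f : MatroidClass 3 19 → ℝ,
      IsValuativeInvariant f ∧
      (∀ c : MatroidClass 3 19,
        (∃ (F : Type u) (_ : Field F), c.IsRepresentableOver F) → 0 ≤ f c) ∧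
      (∃ c : MatroidClass 3 19,
        (¬ ∃ (F : Type u) (_ : Field F), c.IsRepresentableOver F) ∧ f c < 0) := by
  have hlt : latinMatroid.latinDefect < 0 := by
    rw [latinDefect_latinMatroid]
    norm_num
  refine ⟨Quotient.lift LabelledMatroid.latinDefect
    fun _ _ h => LabelledMatroid.latinDefect_eq_of_iso h,
    LabelledMatroid.isValuative_latinDefect, ?_, latinMatroid.toClass, ?_, hlt⟩
  · intro c
    induction c using Quotient.inductionOn with
    | h M =>
      rintro ⟨F, _, hM⟩
      exact M.latinDefect_nonneg_of_isRepresentableOver hM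
  · rintro ⟨F, _, hM⟩
    -- Negativity itself certifies non-representability.
    exact absurd (latinMatroid.latinDefect_nonneg_of_isRepresentableOver hM) (not_le.2 hlt)
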